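/- Let $k\ge 1$. A $k$-graph is a countable small category $\Lambda$ with a functor $d:\Lambda\to\mathbb{N}^k$ such that every $\lambda\in\Lambda$ with $d(\lambda)=m+n$ factors uniquely as $\lambda=\mu\nu$ with $d(\mu)=m$ and $d(\nu)=n$. Write $r,s$ for codomain and domain, $\Lambda^n=d^{-1}(n)$ (so $\Lambda^0$ is identified with the set of objects), and $v\Lambda^n=\{\lambda\in\Lambda^n: r(\lambda)=v\}$. $\Lambda$ is row-finite if every $v\Lambda^n$ is finite, and locally convex if, whenever $i\neq j$, $\lambda\in\Lambda^{e_i}$, $\mu\in\Lambda^{e_j}$ and $r(\lambda)=r(\mu)$, the sets $s(\lambda)\Lambda^{e_j}$ and $s(\mu)\Lambda^{e_i}$ are non-empty. For $d\in(\mathbb{N}\cup\{\infty\})^k$ let $\Omega_{k,d}$ be the category with objects $\{p\in\mathbb{N}^k:p\le d\}$ and one morphism $(p,q)$ of degree $q-p$, with codomain $p$ and domain $q$, for all $p\le q\le d$. A boundary path of $\Lambda$ of degree $d(x)=d$ is a degree-preserving functor $x:\Omega_{k,d}\to\Lambda$ such that $x(p)\Lambda^{e_i}=\emptyset$ whenever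 $p\le d$ and $p_i=d_i$; its range is $r(x)=x(0)$. For $n\le d(x)$, $\sigma^n(x)$ is the boundary path of degree $d(x)-n$ with $\sigma^n(x)(p,q)=x(p+n,q+n)$. For $m\neq n\in\mathbb{N}^k$ and a vertex $v$, $\Lambda$ has local periodicity $m,n$ at $v$ if every boundary path $x$ of $\Lambda$ with $r(x)=v$ satisfies $m-m\wedge d(x)=n-n\wedge d(x)$ and $\sigma^{m\wedge d(x)}(x)=\sigma^{n\wedge d(x)}(x)$, where $\wedge$ is the coordinatewise minimum; $\Lambda$ has no local periodicity if it has local periodicity $m,n$ at $v$ for no vertex $v$ and no $m\neq n$. Let $\Lambda$ be a row-finite locally convex $k$-graph, and let $\widetilde\Lambda$ be the $k$-graph obtained by removing its sources. Its vertices are the classes $[x;m]$, for $x$ a boundary path of $\Lambda$ and $m\in\mathbb{N}^k$, where $[x;m]=[y;n]$ iff $x(m\wedge d(x))=y(n\wedge d(y))$ and $m-m\wedge d(x)=n-n\wedge d(y)$. Its paths are the classes $[x;(m,n)]$, for $m\le n\in\mathbb{N}^k$, where $[x;(m,n)]=[y;(p,q)]$ iff $x(m\wedge d(x),n\wedge d(x))=y(p\wedge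 d(y),q\wedge d(y))$, $m-m\wedge d(x)=p-p\wedge d(y)$ and $n-m=q-p$. The structure maps are $r[x;(m,n)]=[x;m]$, $s[x;(m,n)]=[x;n]$, $\operatorname{id}_{[x;m]}=[x;(m,m)]$, $d[x;(m,n)]=n-m$ and $[x;(m,n)][y;(p,q)]=[x(0,n\wedge d(x))\,\sigma^{p\wedge d(y)}(y);(m,n+q-p)]$ when $[x;n]=[y;p]$. Here, for $\lambda\in\Lambda$ and a boundary path $z$ with $r(z)=s(\lambda)$, $\lambda z$ denotes the unique boundary path of degree $d(\lambda)+d(z)$ with $(\lambda z)(0,d(\lambda))=\lambda$ and $\sigma^{d(\lambda)}(\lambda z)=z$. Let $\pi:\widetilde\Lambda\to\Lambda$ be the projection, $\pi([x;(m,n)])=x(m\wedge d(x),n\wedge d(x))$, so $\pi([x;m])=x(m\wedge d(x))$ on vertices. Then for every vertex $v\in\widetilde\Lambda^0$ and all $m\neq n\in\mathbb{N}^k$, $\widetilde\Lambda$ has local periodicity $m,n$ at $v$ if and only if $\Lambda$ has local periodicity $m,n$ at $\pi(v)$. In particular, $\widetilde\Lambda$ has no local periodicity if and only if $\Lambda$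 has no local periodicity. -/

import Mathlib

universe u

/-- A graph of rank `k`: a countable small category, given by its objects (vertices), its
morphisms (paths), range (codomain), source (domain), identities and composition
(`comp f g _` is the product `f g = f ∘ g`, defined when `s f = r g`), together with a degree
functor to `ℕ ^ k` having the factorisation property. -/
structure KGraph (k : ℕ) where
  Obj : Type u
  Mor : Type u
  r : Mor → Obj
  s : Mor → Obj
  id : Obj → Mor
  comp : (f g : Mor) → s f = r g → Mor
  r_id : ∀ v, r (id v) = v
  s_id : ∀ v, s (id v) = v
  r_comp : ∀ f g h, r (comp f g h) = r f
  s_comp : ∀ f g h, s (comp f g h) = s g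
  id_comp : ∀ f, comp (id (r f)) f (s_id (r f)) = f
  comp_id : ∀ f, comp f (id (s f)) (r_id (s f)).symm = f
  assoc : ∀ f g h (hfg : s f = r g) (hgh : s g = r h),
    comp (comp f g hfg) h ((s_comp f g hfg).trans hgh) =
      comp f (comp g h hgh) (hfg.trans (r_comp g h hgh).symm)
  deg : Mor → Fin k → ℕ
  deg_id : ∀ v, deg (id v) = 0
  deg_comp : ∀ f g h, deg (comp f g h) = deg f + deg g
  factor : ∀ (f : Mor) (m n : Fin k → ℕ), deg f = m + n →
    ∃! p : Mor × Mor, deg p.1 = m ∧ deg p.2 = n ∧ ∃ h : s p.1 = r p.2, comp p.1 p.2 h = f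
  countable_mor : Countable Mor

namespace KGraph

variable {k : ℕ}

/-- `v Λ ^ n` is finite for all vertices `v` and all `n`. -/
def RowFinite (Λ : KGraph.{u} k) : Prop :=
  ∀ (v : Λ.Obj) (n : Fin k → ℕ), {f : Λ.Mor | Λ.r f = v ∧ Λ.deg f = n}.Finite

/-- `v` receives an edge of degree `e i`, that is, `v Λ ^ (e i)` is non-empty. -/
def Receives (Λ : KGraph.{u} k) (v : Λ.Obj) (i : Fin k) : Prop :=
  ∃ f : Λ.Mor, Λ.r f = v ∧ Λ.deg f = Pi.single i 1

/-- If `f` and `g` have the same range and degrees `e i`, `e j` with `i ≠ j`, then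
`s(f) Λ ^ (e j)` and `s(g) Λ ^ (e i)` are non-empty. -/
def LocallyConvex (Λ : KGraph.{u} k) : Prop :=
  ∀ (i j : Fin k), i ≠ j → ∀ f g : Λ.Mor, Λ.deg f = Pi.single i 1 → Λ.deg g = Pi.single j 1 →
    Λ.r f = Λ.r g → Λ.Receives (Λ.s f) j ∧ Λ.Receives (Λ.s g) i

/-- The order `p ≤ d` for `p ∈ ℕ ^ k` and `d ∈ (ℕ ∪ {∞}) ^ k`. -/
def Below (p : Fin k → ℕ) (d : Fin k → ℕ∞) : Prop := ∀ i, (p i : ℕ∞) ≤ d i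

/-- The coordinatewise minimum `m ∧ d ∈ ℕ ^ k` of `m ∈ ℕ ^ k` and `d ∈ (ℕ ∪ {∞}) ^ k`. -/
noncomputable def meet (m : Fin k → ℕ) (d : Fin k → ℕ∞) : Fin k → ℕ :=
  fun i => (min (m i : ℕ∞) (d i)).toNat

theorem meet_cases (m : Fin k → ℕ) (d : Fin k → ℕ∞) (i : Fin k) :
    (d i = ⊤ ∧ meet m d i = m i) ∨ ∃ a : ℕ, d i = a ∧ meet m d i = min (m i) a := by
  unfold meet
  generalize d i = e
  induction e using ENat.recTopCoe with
  | top => left; simp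
  | coe a =>
    right
    refine ⟨a, rfl, ?_⟩
    rcases le_total (m i) a with h | h
    · rw [min_eq_left (by exact_mod_cast h), min_eq_left h, ENat.toNat_natCast]
    · rw [min_eq_right (by exact_mod_cast h), min_eq_right h, ENat.toNat_natCast]

theorem meet_top {m : Fin k → ℕ} {d : Fin k → ℕ∞} {i : Fin k} (h : d i = ⊤) :
    meet m d i = m i := by
  rcases meet_cases m d i with ⟨_, h2⟩ | ⟨a, h1, _⟩
  · exact h2
  · rw [h] at h1; exact absurd h1 (by simp)

theorem meet_nat {m : Fin k → ℕ} {d : Fin k → ℕ∞} {i : Fin k} {a : ℕ} (h : d i = a) :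
    meet m d i = min (m i) a := by
  rcases meet_cases m d i with ⟨h1, _⟩ | ⟨b, h1, h2⟩
  · rw [h] at h1; exact absurd h1 (by simp)
  · rw [h] at h1
    have : a = b := by exact_mod_cast h1
    rw [h2, this]

theorem meet_le (m : Fin k → ℕ) (d : Fin k → ℕ∞) : meet m d ≤ m := by
  intro i
  change meet m d i ≤ m i
  rcases meet_cases m d i with ⟨_, h⟩ | ⟨a, _, h⟩ <;> omega

theorem below_meet (m : Fin k → ℕ) (d : Fin k → ℕ∞) : Below (meet m d) d := by
  intro i
  rcases meet_cases m d i with ⟨h', h⟩ | ⟨a, h', h⟩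
  · simp [h']
  · rw [h', h]; exact_mod_cast min_le_right _ _

theorem meet_mono {m n : Fin k → ℕ} (h : m ≤ n) (d : Fin k → ℕ∞) : meet m d ≤ meet n d := by
  intro i
  have hi : m i ≤ n i := h i
  change meet m d i ≤ meet n d i
  rcases meet_cases m d i with ⟨h1, h2⟩ | ⟨a, h1, h2⟩ <;>
  rcases meet_cases n d i with ⟨h3, h4⟩ | ⟨b, h3, h4⟩
  · omega
  · simp [h1] at h3
  · simp [h1] at h3
  · have : a = b := by rw [h1] at h3; exact_mod_cast h3
    omega

theorem Below.mono {p q : Fin k → ℕ} {d : Fin k → ℕ∞} (h : p ≤ q) (hq : Below q d) :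
    Below p d := fun i => le_trans (by exact_mod_cast h i) (hq i)

theorem below_zero (d : Fin k → ℕ∞) : Below 0 d := fun i => by simp

theorem Below.add {p n : Fin k → ℕ} {d : Fin k → ℕ∞} (hn : Below n d)
    (hp : Below p (fun i => d i - n i)) : Below (p + n) d := by
  intro i
  have h1 := hp i
  have h2 := hn i
  simp only [Pi.add_apply] at *
  revert h1 h2
  generalize d i = e
  induction e using ENat.recTopCoe with
  | top => simp
  | coe a =>
    intro h1 h2
    norm_cast at *
    omega

/-- A boundary path `x` of `Λ`: a degree-preserving functor `Ω_{k,d} → Λ`, where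
`d = dg ∈ (ℕ ∪ {∞}) ^ k` and `Ω_{k,d}` is the category with objects `p ∈ ℕ ^ k`, `p ≤ d`, and
one morphism `(p, q)` of degree `q - p`, with range `p` and source `q`, for all `p ≤ q ≤ d`;
it is required that `x(p) Λ ^ (e i)` is empty whenever `p ≤ d` and `p i = d i`. -/
structure BoundaryPath (Λ : KGraph.{u} k) where
  dg : Fin k → ℕ∞
  obj : (p : Fin k → ℕ) → Below p dg → Λ.Obj
  map : (p q : Fin k → ℕ) → p ≤ q → Below q dg → Λ.Mor
  r_map : ∀ p q hpq hq, Λ.r (map p q hpq hq) = obj p (Below.mono hpq hq)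
  s_map : ∀ p q hpq hq, Λ.s (map p q hpq hq) = obj q hq
  map_id : ∀ p hp, map p p le_rfl hp = Λ.id (obj p hp)
  map_comp : ∀ p q t (hpq : p ≤ q) (hqt : q ≤ t) (ht : Below t dg),
    Λ.comp (map p q hpq (Below.mono hqt ht)) (map q t hqt ht)
      ((s_map _ _ _ _).trans (r_map _ _ _ _).symm) = map p t (hpq.trans hqt) ht
  deg_map : ∀ p q hpq hq, Λ.deg (map p q hpq hq) = q - p
  boundary : ∀ p hp i, (p i : ℕ∞) = dg i → ¬ Λ.Receives (obj p hp) i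

namespace BoundaryPath

variable {Λ : KGraph.{u} k}

/-- The range `r(x) = x(0)`. -/
def range (x : BoundaryPath Λ) : Λ.Obj := x.obj 0 (below_zero _)

/-- The shift `σ ^ n (x)`, of degree `d(x) - n`, for `n ≤ d(x)`:
`σ ^ n (x) (p, q) = x (p + n, q + n)`. -/
def shift (x : BoundaryPath Λ) (n : Fin k → ℕ) (hn : Below n x.dg) : BoundaryPath Λ where
  dg := fun i => x.dg i - n i
  obj := fun p hp => x.obj (p + n) (hn.add hp)
  map := fun p q hpq hq => x.map (p + n) (q + n) (add_le_add_left hpq n) (hn.add hq)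
  r_map := fun _ _ _ _ => x.r_map _ _ _ _
  s_map := fun _ _ _ _ => x.s_map _ _ _ _
  map_id := fun _ _ => x.map_id _ _
  map_comp := fun _ _ _ _ _ _ => x.map_comp _ _ _ _ _ _
  deg_map := fun p q hpq hq => by
    rw [x.deg_map]; funext i; simp only [Pi.sub_apply, Pi.add_apply]; omega
  boundary := fun p hp i h => by
    apply x.boundary
    have h2 := hn i
    revert h h2
    simp only [Pi.add_apply]
    generalize x.dg i = e
    induction e using ENat.recTopCoe with
    | top => simp
    | coe a =>
      intro h1 h2
      norm_cast at *
      omega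

end BoundaryPath

/-- `Λ` has local periodicity `m, n` at `v`: for every boundary path `x` with range `v`,
`m - m ∧ d(x) = n - n ∧ d(x)` and `σ ^ (m ∧ d(x)) (x) = σ ^ (n ∧ d(x)) (x)`. -/
def LocalPeriodicity (Λ : KGraph.{u} k) (m n : Fin k → ℕ) (v : Λ.Obj) : Prop :=
  ∀ x : BoundaryPath Λ, x.range = v →
    m - meet m x.dg = n - meet n x.dg ∧
    x.shift (meet m x.dg) (below_meet m x.dg) = x.shift (meet n x.dg) (below_meet n x.dg)

/-- `Λ` does not have local periodicity `m, n` at `v` for any `m ≠ n` and any vertex `v`. -/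
def NoLocalPeriodicity (Λ : KGraph.{u} k) : Prop :=
  ∀ (m n : Fin k → ℕ), m ≠ n → ∀ v : Λ.Obj, ¬ Λ.LocalPeriodicity m n v

/-! Consequences of the factorisation property, used to build `λ x` and the graph `Λ̃`. -/

section Factor

variable {Λ : KGraph.{u} k}

theorem comp_congr {f f' g g' : Λ.Mor} (hf : f = f') (hg : g = g') (h : Λ.s f = Λ.r g) :
    Λ.comp f g h = Λ.comp f' g' (by rw [← hf, ← hg]; exact h) := by
  subst hf hg; rfl

theorem comp_cancel {f f' g g' : Λ.Mor} {h : Λ.s f = Λ.r g} {h' : Λ.s f' = Λ.r g'}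
    (he : Λ.comp f g h = Λ.comp f' g' h') (hd : Λ.deg f = Λ.deg f') : f = f' ∧ g = g' := by
  have hd' : Λ.deg g = Λ.deg g' := by
    have := congrArg Λ.deg he
    rw [Λ.deg_comp, Λ.deg_comp, hd] at this
    exact add_left_cancel this
  obtain ⟨_, _, hu⟩ := Λ.factor _ _ _ (Λ.deg_comp f g h)
  have h1 := hu (f, g) ⟨rfl, rfl, h, rfl⟩
  have h2 := hu (f', g') ⟨hd.symm, hd'.symm, h', he.symm⟩
  have h3 := h1.trans h2.symm
  exact ⟨congrArg Prod.fst h3, congrArg Prod.snd h3⟩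

theorem exists_factor (f : Λ.Mor) (m : Fin k → ℕ) (h : m ≤ Λ.deg f) :
    ∃ p : Λ.Mor × Λ.Mor, Λ.deg p.1 = m ∧ Λ.deg p.2 = Λ.deg f - m ∧
      ∃ h : Λ.s p.1 = Λ.r p.2, Λ.comp p.1 p.2 h = f :=
  (Λ.factor f m (Λ.deg f - m) (by rw [add_tsub_cancel_of_le h])).exists

/-- The initial segment `f(0, m)`. -/
noncomputable def head (f : Λ.Mor) (m : Fin k → ℕ) (h : m ≤ Λ.deg f) : Λ.Mor :=
  (exists_factor f m h).choose.1

/-- The final segment `f(m, d(f))`. -/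
noncomputable def tail (f : Λ.Mor) (m : Fin k → ℕ) (h : m ≤ Λ.deg f) : Λ.Mor :=
  (exists_factor f m h).choose.2

theorem deg_head (f : Λ.Mor) (m : Fin k → ℕ) (h : m ≤ Λ.deg f) : Λ.deg (head f m h) = m :=
  (exists_factor f m h).choose_spec.1

theorem deg_tail (f : Λ.Mor) (m : Fin k → ℕ) (h : m ≤ Λ.deg f) :
    Λ.deg (tail f m h) = Λ.deg f - m :=
  (exists_factor f m h).choose_spec.2.1

theorem s_head (f : Λ.Mor) (m : Fin k → ℕ) (h : m ≤ Λ.deg f) :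
    Λ.s (head f m h) = Λ.r (tail f m h) :=
  (exists_factor f m h).choose_spec.2.2.choose

theorem head_tail (f : Λ.Mor) (m : Fin k → ℕ) (h : m ≤ Λ.deg f) :
    Λ.comp (head f m h) (tail f m h) (s_head f m h) = f :=
  (exists_factor f m h).choose_spec.2.2.choose_spec

theorem s_tail (f : Λ.Mor) (m : Fin k → ℕ) (h : m ≤ Λ.deg f) :
    Λ.s (tail f m h) = Λ.s f := by
  conv_rhs => rw [← head_tail f m h]
  rw [Λ.s_comp]

theorem eq_head_tail {f a b : Λ.Mor} {m : Fin k → ℕ} {hab : Λ.s a = Λ.r b}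
    (he : Λ.comp a b hab = f) (ha : Λ.deg a = m) (h : m ≤ Λ.deg f) :
    head f m h = a ∧ tail f m h = b :=
  comp_cancel ((head_tail f m h).trans he.symm) ((deg_head f m h).trans ha.symm)

theorem head_comp (a b : Λ.Mor) (hab : Λ.s a = Λ.r b) (m : Fin k → ℕ) (h : m ≤ Λ.deg a)
    (h' : m ≤ Λ.deg (Λ.comp a b hab)) : head (Λ.comp a b hab) m h' = head a m h := by
  have h1 : Λ.comp (head a m h) (Λ.comp (tail a m h) b ((s_tail a m h).trans hab))
      ((s_head a m h).trans (Λ.r_comp _ _ _).symm) = Λ.comp a b hab := by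
    rw [← Λ.assoc _ _ _ (s_head a m h)]
    exact comp_congr (head_tail a m h) rfl _
  exact (eq_head_tail h1 (deg_head a m h) h').1

theorem head_head (f : Λ.Mor) (p q : Fin k → ℕ) (hq : q ≤ Λ.deg f)
    (hp' : p ≤ Λ.deg (head f q hq)) (hp : p ≤ Λ.deg f) :
    head (head f q hq) p hp' = head f p hp := by
  have h := head_tail f q hq
  have h2 := head_comp (head f q hq) (tail f q hq) (s_head f q hq) p hp' (by rw [h]; exact hp)
  rw [← h2]
  congr 1

theorem head_self (f : Λ.Mor) (m : Fin k → ℕ) (hm : m = Λ.deg f) : head f m hm.le = f :=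
  (eq_head_tail (Λ.comp_id f) hm.symm hm.le).1

theorem tail_self (f : Λ.Mor) (m : Fin k → ℕ) (hm : m = Λ.deg f) :
    tail f m hm.le = Λ.id (Λ.s f) :=
  (eq_head_tail (Λ.comp_id f) hm.symm hm.le).2

/-- In a locally convex graph, receiving edges of degree `e i` passes from the range to the
source of a path whose degree vanishes in the direction `i`. -/
theorem LocallyConvex.receives (hΛ : Λ.LocallyConvex) (i : Fin k) :
    ∀ (N : ℕ) (f : Λ.Mor), ∑ j, Λ.deg f j = N → Λ.deg f i = 0 → Λ.Receives (Λ.r f) i →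
      Λ.Receives (Λ.s f) i := by
  intro N
  induction N with
  | zero =>
    intro f hN _ hr
    have h0 : Λ.deg f = 0 := by
      funext j
      exact (Finset.sum_eq_zero_iff.mp hN) j (Finset.mem_univ j)
    have h1 : Λ.comp (Λ.id (Λ.r f)) f (Λ.s_id _) = Λ.comp f (Λ.id (Λ.s f)) (Λ.r_id _).symm := by
      rw [Λ.id_comp, Λ.comp_id]
    have h2 := (comp_cancel h1 (by rw [Λ.deg_id, h0])).1
    have h3 : Λ.r f = Λ.s f := by
      have := congrArg Λ.s h2
      rwa [Λ.s_id] at this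
    rwa [← h3]
  | succ N ih =>
    intro f hN hi hr
    obtain ⟨j, hj⟩ : ∃ j, Λ.deg f j ≠ 0 := by
      by_contra hcon
      push Not at hcon
      simp [hcon] at hN
    have hji : i ≠ j := by rintro rfl; exact hj hi
    have hle : (Pi.single j 1 : Fin k → ℕ) ≤ Λ.deg f := by
      intro l
      by_cases hl : l = j
      · subst hl; simp; omega
      · simp [Pi.single_eq_of_ne hl]
    obtain ⟨g, hg, hgd⟩ := hr
    have hrh : Λ.r (head f _ hle) = Λ.r f := by
      conv_rhs => rw [← head_tail f _ hle]
      rw [Λ.r_comp]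
    have h1 := (hΛ i j hji g (head f _ hle) hgd (deg_head f _ hle) (hg.trans hrh.symm)).2
    rw [s_head] at h1
    rw [← s_tail f _ hle]
    refine ih (tail f _ hle) ?_ ?_ h1
    · have h2 : ∑ l, (Λ.deg (tail f _ hle) l + (Pi.single j 1 : Fin k → ℕ) l) = N + 1 := by
        rw [← hN]
        refine Finset.sum_congr rfl fun l _ => ?_
        have h3 : (Pi.single j 1 : Fin k → ℕ) l ≤ Λ.deg f l := hle l
        rw [deg_tail, Pi.sub_apply]
        omega
      rw [Finset.sum_add_distrib, Finset.sum_pi_single'] at h2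
      simpa using h2
    · rw [deg_tail, Pi.sub_apply, hi, Nat.zero_sub]

end Factor

namespace BoundaryPath

variable {Λ : KGraph.{u} k}

theorem below_sub {f : Λ.Mor} {x : BoundaryPath Λ} {q : Fin k → ℕ}
    (hq : Below q (fun i => (Λ.deg f i : ℕ∞) + x.dg i)) : Below (q - Λ.deg f) x.dg := by
  intro i
  have h1 := hq i
  revert h1
  simp only [Pi.sub_apply]
  generalize x.dg i = e
  induction e using ENat.recTopCoe with
  | top => simp
  | coe a =>
    intro h1
    norm_cast at *
    omega

/-- The path `f x(0, q - d(f))`, whose degree is `q ∨ d(f)`. -/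
def pre (f : Λ.Mor) (x : BoundaryPath Λ) (h : Λ.s f = x.range) (q : Fin k → ℕ)
    (hq : Below q (fun i => (Λ.deg f i : ℕ∞) + x.dg i)) : Λ.Mor :=
  Λ.comp f (x.map 0 (q - Λ.deg f) (fun _ => Nat.zero_le _) (below_sub hq))
    (h.trans (x.r_map _ _ _ _).symm)

theorem le_deg_pre (f : Λ.Mor) (x : BoundaryPath Λ) (h : Λ.s f = x.range) (q : Fin k → ℕ)
    (hq : Below q (fun i => (Λ.deg f i : ℕ∞) + x.dg i)) : q ≤ Λ.deg (pre f x h q hq) := by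
  intro i
  rw [pre, Λ.deg_comp, x.deg_map]
  simp only [Pi.add_apply, Pi.sub_apply, Pi.zero_apply]
  omega

/-- The initial segment `(f x)(0, q)` of `f x`. -/
noncomputable def init (f : Λ.Mor) (x : BoundaryPath Λ) (h : Λ.s f = x.range) (q : Fin k → ℕ)
    (hq : Below q (fun i => (Λ.deg f i : ℕ∞) + x.dg i)) : Λ.Mor :=
  head (pre f x h q hq) q (le_deg_pre f x h q hq)

theorem deg_init (f : Λ.Mor) (x : BoundaryPath Λ) (h : Λ.s f = x.range) (q : Fin k → ℕ)
    (hq : Below q (fun i => (Λ.deg f i : ℕ∞) + x.dg i)) : Λ.deg (init f x h q hq) = q :=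
  deg_head _ _ _

theorem head_init (f : Λ.Mor) (x : BoundaryPath Λ) (h : Λ.s f = x.range) (p q : Fin k → ℕ)
    (hpq : p ≤ q) (hq : Below q (fun i => (Λ.deg f i : ℕ∞) + x.dg i)) :
    head (init f x h q hq) p (hpq.trans (deg_init f x h q hq).ge) =
      init f x h p (Below.mono hpq hq) := by
  have hle : p ≤ Λ.deg (pre f x h q hq) := hpq.trans (le_deg_pre f x h q hq)
  unfold init
  rw [head_head _ p q _ _ hle]
  have hsub : p - Λ.deg f ≤ q - Λ.deg f := fun i => Nat.sub_le_sub_right (hpq i) _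
  have key : Λ.comp (pre f x h p (Below.mono hpq hq))
      (x.map (p - Λ.deg f) (q - Λ.deg f) hsub (below_sub hq))
      (by rw [pre, Λ.s_comp, x.s_map, x.r_map]) = pre f x h q hq := by
    unfold pre
    rw [Λ.assoc _ _ _ _ (by rw [x.s_map, x.r_map])]
    exact comp_congr rfl (x.map_comp _ _ _ _ _ _) _
  have h2 := head_comp (pre f x h p (Below.mono hpq hq))
    (x.map (p - Λ.deg f) (q - Λ.deg f) hsub (below_sub hq))
    (by rw [pre, Λ.s_comp, x.s_map, x.r_map]) p (le_deg_pre f x h p (Below.mono hpq hq)) (by rw [key]; exact hle)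
  rw [← h2]
  congr 1
  exact key.symm

theorem comp_init (f : Λ.Mor) (x : BoundaryPath Λ) (h : Λ.s f = x.range) (p q : Fin k → ℕ)
    (hpq : p ≤ q) (hq : Below q (fun i => (Λ.deg f i : ℕ∞) + x.dg i)) :
    ∃ e, Λ.comp (init f x h p (Below.mono hpq hq))
      (tail (init f x h q hq) p (hpq.trans (deg_init f x h q hq).ge)) e = init f x h q hq := by
  have h1 := head_tail (init f x h q hq) p (hpq.trans (deg_init f x h q hq).ge)
  rw [comp_congr (head_init f x h p q hpq hq) rfl] at h1
  exact ⟨_, h1⟩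

/-- For `deg f ≤ q`, the initial segment `(f x)(0, q)` is `f x(0, q - d(f))`. -/
theorem init_eq_pre (f : Λ.Mor) (x : BoundaryPath Λ) (h : Λ.s f = x.range) (q : Fin k → ℕ)
    (hq : Below q (fun i => (Λ.deg f i : ℕ∞) + x.dg i)) (hf : Λ.deg f ≤ q) :
    init f x h q hq = pre f x h q hq := by
  refine head_self _ _ ?_
  funext i
  have : Λ.deg f i ≤ q i := hf i
  rw [pre, Λ.deg_comp, x.deg_map]
  simp only [Pi.add_apply, Pi.sub_apply, Pi.zero_apply]
  omega

/-- The boundary path `f x` of degree `d(f) + d(x)`, for `s(f) = r(x)`: its initial segment of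
degree `q` is that of `f x(0, q - d(f))`, and `(f x)(p, q)` is the rest of that segment after
its initial segment of degree `p`. -/
noncomputable def concat (hΛ : Λ.LocallyConvex) (f : Λ.Mor) (x : BoundaryPath Λ)
    (h : Λ.s f = x.range) : BoundaryPath Λ where
  dg := fun i => (Λ.deg f i : ℕ∞) + x.dg i
  obj := fun p hp => Λ.s (init f x h p hp)
  map := fun p q hpq hq => tail (init f x h q hq) p (hpq.trans (deg_init f x h q hq).ge)
  r_map := fun p q hpq hq => (comp_init f x h p q hpq hq).choose.symm
  s_map := fun p q hpq hq => s_tail _ _ _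
  map_id := fun p hp => tail_self _ _ (deg_init f x h p hp).symm
  map_comp := fun p q t hpq hqt ht => by
    obtain ⟨e1, h1⟩ := comp_init f x h q t hqt ht
    obtain ⟨e2, h2⟩ := comp_init f x h p q hpq (Below.mono hqt ht)
    refine (eq_head_tail (a := init f x h p (Below.mono (hpq.trans hqt) ht))
      (hab := by rw [Λ.r_comp]; exact e2) ?_ (deg_init _ _ _ _ _) _).2.symm
    rw [← Λ.assoc _ _ _ e2]
    exact (comp_congr h2 rfl _).trans h1
  deg_map := fun p q hpq hq => by rw [deg_tail, deg_init]
  boundary := fun p hp i hi hrec => by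
    have hi' : (Λ.deg f i : ℕ∞) ≤ p i := by rw [hi]; exact le_self_add
    have hi'' : Λ.deg f i ≤ p i := by exact_mod_cast hi'
    have hq : Below (p ⊔ Λ.deg f) (fun i => (Λ.deg f i : ℕ∞) + x.dg i) := by
      intro j
      rcases le_total (p j) (Λ.deg f j) with hj | hj
      · simp [Pi.sup_apply, sup_eq_right.mpr hj]
      · rw [Pi.sup_apply, sup_eq_left.mpr hj]; exact hp j
    obtain ⟨e, he⟩ := comp_init f x h p (p ⊔ Λ.deg f) le_sup_left hq
    rw [e] at hrec
    have h1 := hΛ.receives i _ _ rfl (by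
      rw [deg_tail, deg_init]
      simp only [Pi.sub_apply, Pi.sup_apply]
      omega) hrec
    rw [s_tail, init_eq_pre f x h _ hq le_sup_right, pre, Λ.s_comp, x.s_map] at h1
    refine x.boundary _ _ i ?_ h1
    simp only [Pi.sub_apply, Pi.sup_apply, sup_eq_left.mpr hi'']
    revert hi
    generalize x.dg i = d
    induction d using ENat.recTopCoe with
    | top => simp
    | coe a =>
      intro h1
      norm_cast at *
      omega

end BoundaryPath

/-! Farthing's construction of the graph `Λ̃` without sources. -/

section Tilde

variable {Λ : KGraph.{u} k}

/-- The pairs `(x; m)` with `x` a boundary path and `m ∈ ℕ ^ k`. -/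
structure PreVertex (Λ : KGraph.{u} k) where
  x : BoundaryPath Λ
  m : Fin k → ℕ

/-- The pairs `(x; (m, n))` with `x` a boundary path and `m ≤ n` in `ℕ ^ k`. -/
structure PrePath (Λ : KGraph.{u} k) where
  x : BoundaryPath Λ
  m : Fin k → ℕ
  n : Fin k → ℕ
  le : m ≤ n

/-- The vertex `x(m ∧ d(x))`. -/
noncomputable def PreVertex.base (a : PreVertex Λ) : Λ.Obj :=
  a.x.obj (meet a.m a.x.dg) (below_meet _ _)

/-- The path `x(m ∧ d(x), n ∧ d(x))`. -/
noncomputable def PrePath.base (a : PrePath Λ) : Λ.Mor :=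
  a.x.map (meet a.m a.x.dg) (meet a.n a.x.dg) (meet_mono a.le _) (below_meet _ _)

/-- `(x; m) ∼ (y; n)` iff `x(m ∧ d(x)) = y(n ∧ d(y))` and `m - m ∧ d(x) = n - n ∧ d(y)`. -/
instance vertexSetoid (Λ : KGraph.{u} k) : Setoid (PreVertex Λ) where
  r a b := a.base = b.base ∧ a.m - meet a.m a.x.dg = b.m - meet b.m b.x.dg
  iseqv := ⟨fun _ => ⟨rfl, rfl⟩, fun h => ⟨h.1.symm, h.2.symm⟩,
    fun h h' => ⟨h.1.trans h'.1, h.2.trans h'.2⟩⟩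

/-- `(x; (m, n)) ≈ (y; (p, q))` iff `x(m ∧ d(x), n ∧ d(x)) = y(p ∧ d(y), q ∧ d(y))`,
`m - m ∧ d(x) = p - p ∧ d(y)` and `n - m = q - p`. -/
instance pathSetoid (Λ : KGraph.{u} k) : Setoid (PrePath Λ) where
  r a b := a.base = b.base ∧ a.m - meet a.m a.x.dg = b.m - meet b.m b.x.dg ∧ a.n - a.m = b.n - b.m
  iseqv := ⟨fun _ => ⟨rfl, rfl, rfl⟩, fun h => ⟨h.1.symm, h.2.1.symm, h.2.2.symm⟩,
    fun h h' => ⟨h.1.trans h'.1, h.2.1.trans h'.2.1, h.2.2.trans h'.2.2⟩⟩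

/-- The vertices of `Λ̃`: the classes `[x; m]`. -/
abbrev TObj (Λ : KGraph.{u} k) : Type u := Quotient (vertexSetoid Λ)

/-- The paths of `Λ̃`: the classes `[x; (m, n)]`. -/
abbrev TMor (Λ : KGraph.{u} k) : Type u := Quotient (pathSetoid Λ)

/-- The pair `(x; m)` underlying the range of `[x; (m, n)]`. -/
def PrePath.left (a : PrePath Λ) : PreVertex Λ := ⟨a.x, a.m⟩

/-- The pair `(x; n)` underlying the source of `[x; (m, n)]`. -/
def PrePath.right (a : PrePath Λ) : PreVertex Λ := ⟨a.x, a.n⟩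

theorem PrePath.r_base (a : PrePath Λ) : Λ.r a.base = a.left.base := a.x.r_map _ _ _ _

theorem PrePath.s_base (a : PrePath Λ) : Λ.s a.base = a.right.base := a.x.s_map _ _ _ _

theorem PrePath.deg_base (a : PrePath Λ) :
    Λ.deg a.base = meet a.n a.x.dg - meet a.m a.x.dg := a.x.deg_map _ _ _ _

/-- `n - n ∧ d(x)` in terms of the data that determine `[x; (m, n)]`. -/
theorem PrePath.right_excess (a : PrePath Λ) :
    a.n - meet a.n a.x.dg = (a.m - meet a.m a.x.dg) + (a.n - a.m) - Λ.deg a.base := by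
  funext i
  have h1 : a.m i ≤ a.n i := a.le i
  have h2 : meet a.m a.x.dg i ≤ a.m i := meet_le a.m a.x.dg i
  have h3 : meet a.n a.x.dg i ≤ a.n i := meet_le a.n a.x.dg i
  have h4 : meet a.m a.x.dg i ≤ meet a.n a.x.dg i := meet_mono a.le a.x.dg i
  rw [a.deg_base]
  simp only [Pi.add_apply, Pi.sub_apply]
  omega

theorem left_sound {a b : PrePath Λ} (h : a ≈ b) : a.left ≈ b.left := by
  refine ⟨?_, h.2.1⟩
  rw [← a.r_base, ← b.r_base, h.1]

theorem right_sound {a b : PrePath Λ} (h : a ≈ b) : a.right ≈ b.right := by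
  refine ⟨?_, ?_⟩
  · rw [← a.s_base, ← b.s_base, h.1]
  · change a.n - meet a.n a.x.dg = b.n - meet b.n b.x.dg
    rw [a.right_excess, b.right_excess, h.1, h.2.1, h.2.2]

/-- `r[x; (m, n)] = [x; m]`. -/
def tr : TMor Λ → TObj Λ :=
  Quotient.lift (fun a => Quotient.mk (vertexSetoid Λ) a.left)
    fun _ _ h => Quotient.sound (left_sound h)

/-- `s[x; (m, n)] = [x; n]`. -/
def ts : TMor Λ → TObj Λ :=
  Quotient.lift (fun a => Quotient.mk (vertexSetoid Λ) a.right)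
    fun _ _ h => Quotient.sound (right_sound h)

/-- `d[x; (m, n)] = n - m`. -/
def tdeg : TMor Λ → Fin k → ℕ := Quotient.lift (fun a => a.n - a.m) fun _ _ h => h.2.2

/-- `id [x; m] = [x; (m, m)]`. -/
def tid : TObj Λ → TMor Λ :=
  Quotient.lift (fun a => Quotient.mk (pathSetoid Λ) ⟨a.x, a.m, a.m, le_rfl⟩) fun a b h => by
    refine Quotient.sound ⟨?_, h.2, ?_⟩
    · change a.x.map _ _ _ _ = b.x.map _ _ _ _
      rw [a.x.map_id, b.x.map_id]
      exact congrArg Λ.id h.1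
    · change a.m - a.m = b.m - b.m
      rw [tsub_self, tsub_self]

/-- `(x(0, n ∧ d(x)) σ ^ (p ∧ d(y)) (y); (m, n + (q - p)))`, for `(x; n) ∼ (y; p)`. -/
noncomputable def compRep (hΛ : Λ.LocallyConvex) (a b : PrePath Λ) (h : a.right ≈ b.left) :
    PrePath Λ where
  x := BoundaryPath.concat hΛ
    (a.x.map 0 (meet a.n a.x.dg) (fun _ => Nat.zero_le _) (below_meet _ _))
    (b.x.shift (meet b.m b.x.dg) (below_meet _ _)) (by
      rw [a.x.s_map]
      refine Eq.trans h.1 ?_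
      change b.x.obj _ _ = b.x.obj _ _
      congr 1
      simp [PrePath.left])
  m := a.m
  n := a.n + (b.n - b.m)
  le := a.le.trans le_self_add

theorem compRep_meet (hΛ : Λ.LocallyConvex) (a b : PrePath Λ) (h : a.right ≈ b.left) :
    meet (compRep hΛ a b h).m (compRep hΛ a b h).x.dg = meet a.m a.x.dg ∧
    meet (compRep hΛ a b h).n (compRep hΛ a b h).x.dg =
      meet a.n a.x.dg + (meet b.n b.x.dg - meet b.m b.x.dg) := by
  have hd : ∀ i, (compRep hΛ a b h).x.dg i =
      (meet a.n a.x.dg i : ℕ∞) + (b.x.dg i - (meet b.m b.x.dg i : ℕ)) := by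
    intro i
    change ((Λ.deg _ i : ℕ) : ℕ∞) + _ = _
    rw [a.x.deg_map, tsub_zero]
    rfl
  have hm : (compRep hΛ a b h).m = a.m := rfl
  have hn : (compRep hΛ a b h).n = a.n + (b.n - b.m) := rfl
  have he : ∀ i, a.n i - meet a.n a.x.dg i = b.m i - meet b.m b.x.dg i :=
    fun i => congrFun h.2 i
  rw [hm, hn]
  constructor <;> funext i <;>
  · have h1 : a.m i ≤ a.n i := a.le i
    have h2 : b.m i ≤ b.n i := b.le i
    have h3 := he i
    have h4 := hd i
    have h5 : (a.n + (b.n - b.m)) i = a.n i + (b.n i - b.m i) := rfl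
    try simp only [Pi.add_apply, Pi.sub_apply]
    generalize hx : a.x.dg i = x at *
    generalize hy : b.x.dg i = y at *
    induction x using ENat.recTopCoe <;> induction y using ENat.recTopCoe
    all_goals
      first
      | rw [ENat.top_sub_natCast, add_top] at h4
      | norm_cast at h4
      first
      | rw [meet_top hx] at *
      | rw [meet_nat hx] at *
      try rw [meet_top hx] at *
      try rw [meet_nat hx] at *
      first
      | rw [meet_top hy] at *
      | rw [meet_nat hy] at *
      try rw [meet_top hy] at *
      try rw [meet_nat hy] at *
      first
      | rw [meet_top h4]
      | rw [meet_nat h4]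
      try omega

theorem map_congr (x : BoundaryPath Λ) {p q p' q' : Fin k → ℕ} (hp : p = p') (hq : q = q')
    (hpq : p ≤ q) (hb : Below q x.dg) :
    x.map p q hpq hb = x.map p' q' (hp ▸ hq ▸ hpq) (hq ▸ hb) := by
  subst hp hq; rfl

theorem base_comm {a b : PrePath Λ} (h : a.right ≈ b.left) : Λ.s a.base = Λ.r b.base :=
  a.s_base.trans (h.1.trans b.r_base.symm)

theorem compRep_base (hΛ : Λ.LocallyConvex) (a b : PrePath Λ) (h : a.right ≈ b.left) :
    (compRep hΛ a b h).base = Λ.comp a.base b.base (base_comm h) := by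
  obtain ⟨hm, hn⟩ := compRep_meet hΛ a b h
  have hf : Λ.deg (a.x.map 0 (meet a.n a.x.dg) (fun _ => Nat.zero_le _) (below_meet _ _)) =
      meet a.n a.x.dg := by rw [a.x.deg_map, tsub_zero]
  have hab : Λ.s (a.x.map 0 (meet a.m a.x.dg) (fun _ => Nat.zero_le _) (below_meet _ _)) =
      Λ.r a.base := (a.x.s_map _ _ _ _).trans a.r_base.symm
  refine (map_congr (compRep hΛ a b h).x hm hn _ _).trans ?_
  refine (eq_head_tail (b := Λ.comp a.base b.base (base_comm h))
    (hab := hab.trans (Λ.r_comp _ _ _).symm)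
    (Eq.trans ?_ (BoundaryPath.init_eq_pre _ _ _ _ _ (hf.le.trans le_self_add)).symm)
    ((a.x.deg_map _ _ _ _).trans (tsub_zero _))
    (((meet_mono a.le _).trans le_self_add).trans (BoundaryPath.deg_init _ _ _ _ _).ge)).2
  unfold BoundaryPath.pre
  rw [← Λ.assoc _ _ _ hab]
  refine comp_congr (a.x.map_comp _ _ _ _ _ _) (map_congr b.x ?_ ?_ _ _).symm _
  · exact zero_add _
  · rw [hf, add_tsub_cancel_left, tsub_add_cancel_of_le (meet_mono b.le _)]

theorem compRep_excess (hΛ : Λ.LocallyConvex) (a b : PrePath Λ) (h : a.right ≈ b.left) :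
    (compRep hΛ a b h).m - meet (compRep hΛ a b h).m (compRep hΛ a b h).x.dg =
      a.m - meet a.m a.x.dg := by
  rw [(compRep_meet hΛ a b h).1]; rfl

theorem compRep_deg (hΛ : Λ.LocallyConvex) (a b : PrePath Λ) (h : a.right ≈ b.left) :
    (compRep hΛ a b h).n - (compRep hΛ a b h).m = (a.n - a.m) + (b.n - b.m) := by
  change a.n + (b.n - b.m) - a.m = _
  funext i
  have h1 : a.m i ≤ a.n i := a.le i
  simp only [Pi.add_apply, Pi.sub_apply]
  omega

theorem compRep_sound (hΛ : Λ.LocallyConvex) {a b a' b' : PrePath Λ} (h : a.right ≈ b.left)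
    (h' : a'.right ≈ b'.left) (ha : a ≈ a') (hb : b ≈ b') :
    compRep hΛ a b h ≈ compRep hΛ a' b' h' := by
  refine ⟨?_, ?_, ?_⟩
  · rw [compRep_base, compRep_base]
    exact comp_congr ha.1 hb.1 _
  · rw [compRep_excess, compRep_excess]
    exact ha.2.1
  · rw [compRep_deg, compRep_deg, ha.2.2, hb.2.2]

/-- The composition of `Λ̃`:
`[x; (m, n)] [y; (p, q)] = [x(0, n ∧ d(x)) σ ^ (p ∧ d(y)) (y); (m, n + q - p)]`. -/
noncomputable def tcomp (hΛ : Λ.LocallyConvex) (f g : TMor Λ) (h : ts f = tr g) : TMor Λ :=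
  Quotient.mk (pathSetoid Λ) (compRep hΛ f.out g.out (Quotient.exact (by
    rw [← Quotient.out_eq f, ← Quotient.out_eq g] at h
    exact h)))

/-- The composition does not depend on the chosen representatives. -/
theorem tcomp_mk (hΛ : Λ.LocallyConvex) (a b : PrePath Λ)
    (h : ts (Quotient.mk (pathSetoid Λ) a) = tr (Quotient.mk (pathSetoid Λ) b)) :
    tcomp hΛ (Quotient.mk _ a) (Quotient.mk _ b) h =
      Quotient.mk (pathSetoid Λ) (compRep hΛ a b (Quotient.exact h)) :=
  Quotient.sound (compRep_sound hΛ _ _ (Quotient.mk_out a) (Quotient.mk_out b))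

theorem deg_base_left {a b : PrePath Λ} (h : a.right ≈ b.left) (i : Fin k) :
    Λ.deg a.base i = if (a.m - meet a.m a.x.dg) i = 0 then
      min ((a.n - a.m) i) (Λ.deg (Λ.comp a.base b.base (base_comm h)) i) else 0 := by
  have he : a.n i - meet a.n a.x.dg i = b.m i - meet b.m b.x.dg i := congrFun h.2 i
  have h1 : a.m i ≤ a.n i := a.le i
  have h2 : b.m i ≤ b.n i := b.le i
  rw [Λ.deg_comp, a.deg_base, b.deg_base]
  simp only [Pi.add_apply, Pi.sub_apply]
  generalize hx : a.x.dg i = x at *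
  generalize hy : b.x.dg i = y at *
  induction x using ENat.recTopCoe <;> induction y using ENat.recTopCoe
  all_goals
    first
    | rw [meet_top hx, meet_top hx] at *
    | rw [meet_nat hx, meet_nat hx] at *
    first
    | rw [meet_top hy, meet_top hy] at *
    | rw [meet_nat hy, meet_nat hy] at *
    split_ifs <;> omega

theorem compRep_cancel (hΛ : Λ.LocallyConvex) {a b a' b' : PrePath Λ} (h : a.right ≈ b.left)
    (h' : a'.right ≈ b'.left) (hc : compRep hΛ a b h ≈ compRep hΛ a' b' h')
    (hd : a.n - a.m = a'.n - a'.m) : a ≈ a' ∧ b ≈ b' := by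
  obtain ⟨h1, h2, h3⟩ := hc
  rw [compRep_base, compRep_base] at h1
  rw [compRep_excess, compRep_excess] at h2
  rw [compRep_deg, compRep_deg, hd] at h3
  have h4 : Λ.deg a.base = Λ.deg a'.base := by
    funext i
    rw [deg_base_left h, deg_base_left h', h1, h2, hd]
  obtain ⟨h5, h6⟩ := comp_cancel h1 h4
  have h7 : a ≈ a' := ⟨h5, h2, hd⟩
  have h8 : b.left ≈ b'.left :=
    Setoid.trans (Setoid.symm h) (Setoid.trans (right_sound h7) h')
  exact ⟨h7, h6, h8.2, add_left_cancel h3⟩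

/-- The `k`-graph `Λ̃` obtained from the row-finite locally convex `k`-graph `Λ` by removing
sources. -/
noncomputable def tilde (Λ : KGraph.{u} k) (hΛ : Λ.LocallyConvex) : KGraph.{u} k where
  Obj := TObj Λ
  Mor := TMor Λ
  r := tr
  s := ts
  id := tid
  comp := tcomp hΛ
  r_id := by rintro ⟨a⟩; rfl
  s_id := by rintro ⟨a⟩; rfl
  r_comp := by
    intro f g h
    induction f using Quotient.ind with | _ a
    induction g using Quotient.ind with | _ b
    rw [tcomp_mk]
    refine Quotient.sound ⟨?_, compRep_excess hΛ a b (Quotient.exact h)⟩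
    rw [← PrePath.r_base, compRep_base, Λ.r_comp, PrePath.r_base]
  s_comp := by
    intro f g h
    induction f using Quotient.ind with | _ a
    induction g using Quotient.ind with | _ b
    have h0 : a.right ≈ b.left := Quotient.exact h
    rw [tcomp_mk]
    refine Quotient.sound ⟨?_, ?_⟩
    · rw [← PrePath.s_base, compRep_base, Λ.s_comp, PrePath.s_base]
    · refine (PrePath.right_excess _).trans (Eq.trans ?_ (PrePath.right_excess _).symm)
      rw [compRep_base, compRep_excess, compRep_deg, Λ.deg_comp]
      have h1 : b.m - meet b.m b.x.dg = _ := h0.2.symm.trans a.right_excess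
      rw [h1]
      funext i
      have h2 : Λ.deg a.base i ≤ (a.m - meet a.m a.x.dg) i + (a.n - a.m) i := by
        rw [a.deg_base]
        have h1 : a.m i ≤ a.n i := a.le i
        have h2 : meet a.m a.x.dg i ≤ a.m i := meet_le a.m a.x.dg i
        have h3 : meet a.n a.x.dg i ≤ a.n i := meet_le a.n a.x.dg i
        simp only [Pi.sub_apply]
        omega
      simp only [Pi.add_apply, Pi.sub_apply] at *
      omega
  id_comp := by
    rintro ⟨a⟩
    refine (tcomp_mk hΛ ⟨a.x, a.m, a.m, le_rfl⟩ a _).trans (Quotient.sound ⟨?_, ?_, ?_⟩)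
    · rw [compRep_base]
      exact a.x.map_comp _ _ _ _ _ _
    · exact compRep_excess ..
    · rw [compRep_deg]; simp
  comp_id := by
    rintro ⟨a⟩
    refine (tcomp_mk hΛ a ⟨a.x, a.n, a.n, le_rfl⟩ _).trans (Quotient.sound ⟨?_, ?_, ?_⟩)
    · rw [compRep_base]
      exact a.x.map_comp _ _ _ _ _ _
    · exact compRep_excess ..
    · rw [compRep_deg]; simp
  assoc := by
    intro f g h hfg hgh
    induction f using Quotient.ind with | _ a
    induction g using Quotient.ind with | _ b
    induction h using Quotient.ind with | _ c
    simp only [tcomp_mk]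
    refine Quotient.sound ⟨?_, ?_, ?_⟩
    · simp only [compRep_base]
      exact Λ.assoc _ _ _ _ _
    · simp only [compRep_excess]
    · simp only [compRep_deg, add_assoc]
  deg := tdeg
  deg_id := by
    rintro ⟨a⟩
    exact tsub_self a.m
  deg_comp := by
    intro f g h
    induction f using Quotient.ind with | _ a
    induction g using Quotient.ind with | _ b
    rw [tcomp_mk]
    exact compRep_deg ..
  factor := by
    intro f m n hf
    induction f using Quotient.ind with | _ a
    have hf' : a.n - a.m = m + n := hf
    have hn : a.m + m ≤ a.n := by
      intro i
      have h1 : a.n i - a.m i = m i + n i := congrFun hf' i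
      have h2 : a.m i ≤ a.n i := a.le i
      change a.m i + m i ≤ a.n i
      omega
    let b : PrePath Λ := ⟨a.x, a.m, a.m + m, le_self_add⟩
    let c : PrePath Λ := ⟨a.x, a.m + m, a.n, hn⟩
    have hbd : b.n - b.m = m := add_tsub_cancel_left a.m m
    have hcd : c.n - c.m = n := by
      change a.n - (a.m + m) = n
      rw [← tsub_tsub, hf', add_tsub_cancel_left]
    have hbc : b.right ≈ c.left := Setoid.refl _
    have hcomp : compRep hΛ b c hbc ≈ a := by
      refine ⟨?_, ?_, ?_⟩
      · rw [compRep_base]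
        exact a.x.map_comp _ _ _ _ _ _
      · exact compRep_excess ..
      · rw [compRep_deg, hbd, hcd, hf']
    refine ⟨(Quotient.mk _ b, Quotient.mk _ c), ⟨hbd, hcd, rfl, ?_⟩, ?_⟩
    · exact (tcomp_mk hΛ b c rfl).trans (Quotient.sound hcomp)
    · rintro ⟨p, q⟩ ⟨hp, hq, h, hpq⟩
      induction p using Quotient.ind with | _ b'
      induction q using Quotient.ind with | _ c'
      rw [tcomp_mk] at hpq
      have h1 := compRep_cancel hΛ (Quotient.exact h) hbc
        (Setoid.trans (Quotient.exact hpq) (Setoid.symm hcomp)) (Eq.trans hp hbd.symm)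
      exact Prod.ext (Quotient.sound h1.1) (Quotient.sound h1.2)
  countable_mor := by
    have := Λ.countable_mor
    let key : TMor Λ → Λ.Mor × (Fin k → ℕ) × (Fin k → ℕ) :=
      Quotient.lift (fun a => (a.base, a.m - meet a.m a.x.dg, a.n - a.m))
        fun a b h => Prod.ext h.1 (Prod.ext h.2.1 h.2.2)
    have hkey : Function.Injective key := by
      rintro ⟨a⟩ ⟨b⟩ h
      have h1 : (a.base, a.m - meet a.m a.x.dg, a.n - a.m) =
        (b.base, b.m - meet b.m b.x.dg, b.n - b.m) := h
      simp only [Prod.mk.injEq] at h1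
      exact Quotient.sound h1
    exact hkey.countable

/-- The projection `π : Λ̃ → Λ` on paths: `π [x; (m, n)] = x(m ∧ d(x), n ∧ d(x))`. -/
noncomputable def projMor (Λ : KGraph.{u} k) (hΛ : Λ.LocallyConvex) :
    (Λ.tilde hΛ).Mor → Λ.Mor :=
  Quotient.lift PrePath.base fun _ _ h => h.1

/-- The projection `π : Λ̃ → Λ` on vertices: `π [x; m] = x(m ∧ d(x))`. -/
noncomputable def projObj (Λ : KGraph.{u} k) (hΛ : Λ.LocallyConvex) :
    (Λ.tilde hΛ).Obj → Λ.Obj :=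
  Quotient.lift PreVertex.base fun _ _ h => h.1

/-- The two parts of `π` agree when vertices are identified with identity paths. -/
theorem projMor_id (Λ : KGraph.{u} k) (hΛ : Λ.LocallyConvex) (v : (Λ.tilde hΛ).Obj) :
    Λ.projMor hΛ ((Λ.tilde hΛ).id v) = Λ.id (Λ.projObj hΛ v) := by
  induction v using Quotient.ind with | _ a
  exact a.x.map_id _ _

end Tilde

end KGraph

namespace KGraph

variable {k : ℕ} {Λ : KGraph.{u} k}

/-! A vertex `[x; m]` of `Λ̃` is determined by its projection to `Λ` and its excess `m - m ∧ d(x)`;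
a path is determined by its projection, the excess of its range and its degree. Since `Λ̃` has no
sources, its boundary paths are infinite in every direction.

Boundary paths `X` of `Λ̃` with range `v` correspond to boundary paths `y` of `Λ` with range `π(v)`:
with `a` the excess of `v`, `X(p, q) = [y; (a + p, a + q)]`. A direction with `a i ≠ 0` is one in
which `π(v)` receives no edge, so `d(y)` vanishes there and truncation at `d(y)` ignores `a`. Hence
`X(p, q)` projects to `y(p ∧ d(y), q ∧ d(y))` and `X(p)` has excess `a + (p - p ∧ d(y))`. This is
`Lifts`; `exists_lift` builds `X` from `y`, and `exists_lifts` recovers `y` from `X`.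

By the determining data, `σ^m(X) = σ^n(X)` says that projections and excesses agree at all positions
`p + m` and `p + n`. In `Lifts.periodic_iff` this becomes the pair of conditions on `y`: excesses at
`p = 0` give `m - m ∧ d(y) = n - n ∧ d(y)`, and projections give the equality of shifts.

For the last claim `π` must be onto vertices, that is, every vertex of `Λ` must start a boundary
path. A greedy extension produces one, and local convexity ensures that its limit satisfies the
boundary condition. -/

/-! ### Truncation of positions at a degree -/

theorem meet_of_below {m : Fin k → ℕ} {d : Fin k → ℕ∞} (h : Below m d) : meet m d = m := by
  funext i
  unfold meet
  rw [min_eq_left (h i), ENat.toNat_natCast]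

/-- Moving along a path by `m` and then by `p` spends `m ∧ d` first; only `d - m ∧ d` is left for
`p`. This locates position `p + m` inside the shift by `m ∧ d`. -/
theorem meet_add_right (p m : Fin k → ℕ) (d : Fin k → ℕ∞) :
    meet (p + m) d = meet p (fun i => d i - meet m d i) + meet m d := by
  funext i
  rw [Pi.add_apply]
  rcases meet_cases m d i with ⟨h1, h2⟩ | ⟨a, h1, h2⟩
  · rw [meet_top h1, meet_top (by rw [h1]; exact ENat.top_sub_natCast _), h2, Pi.add_apply]
  · have h3 : d i - meet m d i = ((a - meet m d i : ℕ) : ℕ∞) := by rw [h1]; norm_cast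
    rw [meet_nat h1, meet_nat h3, h2, Pi.add_apply]
    omega

theorem exists_le_of_le_iSup {ι : Type*} [Nonempty ι] {f : ι → ℕ} {N : ℕ}
    (h : (N : ℕ∞) ≤ ⨆ j, (f j : ℕ∞)) : ∃ j, N ≤ f j := by
  by_contra! hcon
  have h2 : ⨆ j, (f j : ℕ∞) ≤ ((N - 1 : ℕ) : ℕ∞) := iSup_le fun j => by
    have := hcon j
    exact_mod_cast (by omega : f j ≤ N - 1)
  have h3 : N ≤ N - 1 := by exact_mod_cast h.trans h2
  -- With truncated subtraction `N ≤ N - 1` leaves `N = 0`, which any single term `f j < 0` rules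
  -- out.
  have := hcon (Classical.arbitrary ι)
  omega

/-! ### Equality and construction of boundary paths -/

namespace BoundaryPath

/-- Objects need no hypothesis of their own: `x(p)` is the range of `x(p, p)`. -/
theorem map_ext {x y : BoundaryPath Λ} (hd : x.dg = y.dg)
    (hm : ∀ p q hpq hx hy, x.map p q hpq hx = y.map p q hpq hy) : x = y := by
  have ho : ∀ p hx hy, x.obj p hx = y.obj p hy := fun p hx hy => by
    rw [← x.r_map p p le_rfl hx, hm p p le_rfl hx hy, y.r_map]
  obtain ⟨d, xo, xm⟩ := x
  obtain ⟨e, yo, ym⟩ := y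
  obtain rfl : d = e := hd
  obtain rfl : xo = yo := by funext p hp; exact ho p hp hp
  obtain rfl : xm = ym := by funext p q h hq; exact hm p q h hq hq
  rfl

theorem shift_congr (x : BoundaryPath Λ) {m n : Fin k → ℕ} (h : m = n) (hm : Below m x.dg)
    (hn : Below n x.dg) : x.shift m hm = x.shift n hn := by
  subst h; rfl

theorem map_eq_of_shift_eq {x : BoundaryPath Λ} {m n : Fin k → ℕ} {hm : Below m x.dg}
    {hn : Below n x.dg} (h : x.shift m hm = x.shift n hn) (p q : Fin k → ℕ) (hpq : p ≤ q)
    (hq : Below (q + m) x.dg) (hq' : Below (q + n) x.dg)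
    (hb : Below q (x.shift m hm).dg) :
    x.map (p + m) (q + m) (add_le_add_left hpq m) hq =
      x.map (p + n) (q + n) (add_le_add_left hpq n) hq' := by
  -- Generalising both shifts to variables lets the equality be substituted although the degree
  -- occurs in the types.
  have key : ∀ z w : BoundaryPath Λ, z = w → ∀ (hz : Below q z.dg) (hw : Below q w.dg),
      z.map p q hpq hz = w.map p q hpq hw := by
    rintro z _ rfl _ _; rfl
  exact key _ _ h hb (h ▸ hb)

theorem receives_of_dg_ne_zero (x : BoundaryPath Λ) {i : Fin k} (h : x.dg i ≠ 0) :
    Λ.Receives x.range i := by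
  have hb : Below (Pi.single i 1) x.dg := by
    intro j
    by_cases hj : j = i
    · subst hj; simpa using Order.one_le_iff_ne_zero.mpr h
    · simp [Pi.single_eq_of_ne hj]
  exact ⟨x.map 0 _ (fun _ => Nat.zero_le _) hb, x.r_map _ _ _ _, by rw [x.deg_map, tsub_zero]⟩

/-- A boundary path of a graph without sources has infinite degree. -/
theorem below_of_receives (hΛ : ∀ v i, Λ.Receives v i) (x : BoundaryPath Λ) (q : Fin k → ℕ) :
    Below q x.dg := by
  intro i
  rcases h : x.dg i with _ | a
  · exact le_top
  -- A finite `d(x) i = a` would put position `a e_i` on the boundary in direction `i`.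
  · have hb : Below (Pi.single i a) x.dg := by
      intro j
      by_cases hj : j = i
      · subst hj; rw [Pi.single_eq_same]; exact h.ge
      · simp [Pi.single_eq_of_ne hj]
    refine absurd (hΛ _ i) (x.boundary _ hb i ?_)
    rw [Pi.single_eq_same]; exact h.symm

/-- A boundary path given by its initial segments. -/
noncomputable def ofInit (d : Fin k → ℕ∞) (F : (q : Fin k → ℕ) → Below q d → Λ.Mor)
    (hF : ∀ q hq, Λ.deg (F q hq) = q)
    (hh : ∀ p q (hpq : p ≤ q) hq,
      head (F q hq) p (hpq.trans (hF q hq).ge) = F p (Below.mono hpq hq))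
    (hb : ∀ p hp i, (p i : ℕ∞) = d i → ¬ Λ.Receives (Λ.s (F p hp)) i) : BoundaryPath Λ :=
  have hs : ∀ p q (hpq : p ≤ q) hq, Λ.s (F p (Below.mono hpq hq)) =
      Λ.r (tail (F q hq) p (hpq.trans (hF q hq).ge)) := fun p q hpq hq => by
    rw [← hh p q hpq hq]; exact s_head _ _ _
  have hc : ∀ p q (hpq : p ≤ q) hq, Λ.comp (F p (Below.mono hpq hq))
      (tail (F q hq) p (hpq.trans (hF q hq).ge)) (hs p q hpq hq) = F q hq :=
    fun p q hpq hq => (comp_congr (hh p q hpq hq).symm rfl _).trans (head_tail _ _ _)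
  { dg := d
    obj := fun p hp => Λ.s (F p hp)
    map := fun p q hpq hq => tail (F q hq) p (hpq.trans (hF q hq).ge)
    r_map := fun p q hpq hq => (hs p q hpq hq).symm
    s_map := fun _ _ _ _ => s_tail _ _ _
    map_id := fun p hp => tail_self _ _ (hF p hp).symm
    map_comp := fun p q t hpq hqt ht => by
      refine (eq_head_tail (a := F p (Below.mono (hpq.trans hqt) ht))
        (hab := by rw [Λ.r_comp]; exact hs p q hpq _) ?_ (hF _ _) _).2.symm
      rw [← Λ.assoc _ _ _ (hs p q hpq (Below.mono hqt ht))]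
      exact (comp_congr (hc p q hpq _) rfl _).trans (hc q t hqt ht)
    deg_map := fun p q hpq hq => by rw [deg_tail, hF]
    boundary := hb }

end BoundaryPath

/-! ### Existence of boundary paths -/

/-- Every vertex is the range of a path whose degree is non-zero in each direction in which the path
can be extended. -/
theorem exists_greedy (Λ : KGraph.{u} k) (v : Λ.Obj) :
    ∃ f : Λ.Mor, Λ.r f = v ∧ ∀ i, Λ.deg f i = 0 → ¬ Λ.Receives (Λ.s f) i := by
  by_contra! hcon
  -- If every path could be extended in an unused direction, degrees bounded by 1 in each coordinate
  -- would have arbitrarily large sum, exceeding `k`.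
  have key : ∀ N : ℕ, ∃ f : Λ.Mor, Λ.r f = v ∧ (∀ i, Λ.deg f i ≤ 1) ∧
      N ≤ ∑ i, Λ.deg f i := by
    intro N
    induction N with
    | zero => exact ⟨Λ.id v, Λ.r_id v, fun i => by simp [Λ.deg_id], Nat.zero_le _⟩
    | succ N ih =>
      obtain ⟨f, hf, h1, hN⟩ := ih
      obtain ⟨i, hi, g, hg, hgd⟩ := hcon f hf
      refine ⟨Λ.comp f g hg.symm, (Λ.r_comp _ _ _).trans hf, fun j => ?_, ?_⟩
      · rw [Λ.deg_comp, hgd, Pi.add_apply]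
        by_cases hj : j = i
        · subst hj; simp [hi]
        · simpa [Pi.single_eq_of_ne hj] using h1 j
      · rw [Λ.deg_comp, hgd]
        simp only [Pi.add_apply, Finset.sum_add_distrib, Finset.sum_pi_single']
        simpa using hN
  obtain ⟨f, -, h1, h2⟩ := key (k + 1)
  have h3 : ∑ i, Λ.deg f i ≤ ∑ _i : Fin k, 1 := Finset.sum_le_sum fun i _ => h1 i
  simp at h3
  omega

/-- The iterated greedy extension of the identity path at `v`. -/
noncomputable def greedyPath (v : Λ.Obj) : ℕ → Λ.Mor
  | 0 => Λ.id v
  | j + 1 => Λ.comp (greedyPath v j) (exists_greedy Λ (Λ.s (greedyPath v j))).choose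
      (exists_greedy Λ (Λ.s (greedyPath v j))).choose_spec.1.symm

theorem r_greedyPath (v : Λ.Obj) (j : ℕ) : Λ.r (greedyPath v j) = v := by
  induction j with
  | zero => exact Λ.r_id v
  | succ j ih => exact (Λ.r_comp _ _ _).trans ih

theorem deg_greedyPath_mono (v : Λ.Obj) : Monotone fun j => Λ.deg (greedyPath v j) :=
  monotone_nat_of_le_succ fun j => by
    simp only [greedyPath, Λ.deg_comp]
    exact le_self_add

theorem head_greedyPath (v : Λ.Obj) {j l : ℕ} (hjl : j ≤ l) (p : Fin k → ℕ)
    (hj : p ≤ Λ.deg (greedyPath v j)) (hl : p ≤ Λ.deg (greedyPath v l)) :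
    head (greedyPath v l) p hl = head (greedyPath v j) p hj := by
  induction l, hjl using Nat.le_induction with
  | base => rfl
  | succ l hjl ih =>
    have h : p ≤ Λ.deg (greedyPath v l) := hj.trans (deg_greedyPath_mono v hjl)
    rw [← ih h]
    exact head_comp _ _ _ p h hl

/-- No growth in direction `i` means that the appended greedy piece has degree zero there, hence
ends where direction `i` is blocked. -/
theorem not_receives_greedyPath (v : Λ.Obj) (j : ℕ) (i : Fin k)
    (h : Λ.deg (greedyPath v (j + 1)) i ≤ Λ.deg (greedyPath v j) i) :
    ¬ Λ.Receives (Λ.s (greedyPath v (j + 1))) i := by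
  have h2 := (exists_greedy Λ (Λ.s (greedyPath v j))).choose_spec.2 i
  simp only [greedyPath, Λ.deg_comp, Pi.add_apply, Λ.s_comp] at h ⊢
  exact h2 (by omega)

/-- In a locally convex graph every vertex is the range of a boundary path. -/
theorem LocallyConvex.exists_boundaryPath (hΛ : Λ.LocallyConvex) (v : Λ.Obj) :
    ∃ x : BoundaryPath Λ, x.range = v := by
  let d : Fin k → ℕ∞ := fun i => ⨆ j, (Λ.deg (greedyPath v j) i : ℕ∞)
  have hd : ∀ q, Below q d → ∃ j, q ≤ Λ.deg (greedyPath v j) := by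
    intro q hq
    have h1 : ∀ i, ∃ j, q i ≤ Λ.deg (greedyPath v j) i := fun i => exists_le_of_le_iSup (hq i)
    choose J hJ using h1
    exact ⟨Finset.univ.sup J, fun i => (hJ i).trans
      (deg_greedyPath_mono v (Finset.le_sup (Finset.mem_univ i)) i)⟩
  choose J hJ using hd
  have hhead : ∀ p j l (hj : p ≤ Λ.deg (greedyPath v j)) (hl : p ≤ Λ.deg (greedyPath v l)),
      head (greedyPath v j) p hj = head (greedyPath v l) p hl := by
    intro p j l hj hl
    rcases le_total j l with h | h
    · exact (head_greedyPath v h p hj hl).symm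
    · exact head_greedyPath v h p hl hj
  refine ⟨BoundaryPath.ofInit d (fun q hq => head (greedyPath v (J q hq)) q (hJ q hq))
    (fun q hq => deg_head _ _ _) ?_ ?_, ?_⟩
  · intro p q hpq hq
    rw [head_head _ _ _ _ _ (hpq.trans (hJ q hq))]
    exact hhead _ _ _ _ _
  · intro p hp i hi hrec
    -- One stage beyond `J` is needed: stage `J` already has degree `p i = d i`, so the next piece
    -- does not grow in direction `i` and its source is blocked. Local convexity would carry an edge
    -- at position `p` to that source.
    have hle : p ≤ Λ.deg (greedyPath v (J p hp + 1)) :=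
      (hJ p hp).trans (deg_greedyPath_mono v (Nat.le_succ _))
    have hdeg : ∀ j, Λ.deg (greedyPath v j) i ≤ p i := fun j => by
      have h1 : (Λ.deg (greedyPath v j) i : ℕ∞) ≤ d i :=
        le_iSup (fun j => (Λ.deg (greedyPath v j) i : ℕ∞)) j
      rw [← hi] at h1
      exact_mod_cast h1
    rw [hhead p _ _ (hJ p hp) hle, s_head] at hrec
    have h2 := hΛ.receives i _ _ rfl (by
      rw [deg_tail, Pi.sub_apply, Nat.sub_eq_zero_of_le (hdeg _)]) hrec
    rw [s_tail] at h2
    exact not_receives_greedyPath v _ i ((hdeg _).trans (hJ p hp i)) h2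
  · have h0 : ∀ f : Λ.Mor, ∀ h, Λ.s (head f 0 h) = Λ.r f := fun f h => by
      have h1 := eq_head_tail (Λ.id_comp f) (Λ.deg_id _) h
      rw [h1.1, Λ.s_id]
    exact (h0 _ _).trans (r_greedyPath v _)


/-- Both `(fg) id` and `f g` factor `fg` with left factors of equal degree, so unique factorisation
applies. -/
theorem comp_of_deg_eq_zero (f g : Λ.Mor) (h : Λ.s f = Λ.r g) (hg : Λ.deg g = 0) :
    Λ.comp f g h = f :=
  (comp_cancel (Λ.comp_id (Λ.comp f g h)) (by rw [Λ.deg_comp, hg, add_zero])).1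

theorem BoundaryPath.obj_congr (x : BoundaryPath Λ) {p q : Fin k → ℕ} (h : p = q)
    (hp : Below p x.dg) : x.obj p hp = x.obj q (h ▸ hp) := by
  subst h; rfl

/-! ### Projection and excess as invariants in `Λ̃` -/

section Tilde

variable {hΛ : Λ.LocallyConvex}

/-- The invariant `m - m ∧ d(x)` of the vertex `[x; m]`. -/
noncomputable def excess (v : (Λ.tilde hΛ).Obj) : Fin k → ℕ :=
  Quotient.lift (fun a : PreVertex Λ => a.m - meet a.m a.x.dg)
    (fun a b (h : a.base = b.base ∧ _) => h.2) v

theorem tilde_obj_ext {v w : (Λ.tilde hΛ).Obj} (h : Λ.projObj hΛ v = Λ.projObj hΛ w)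
    (he : excess v = excess w) : v = w := by
  induction v using Quotient.ind with | _ a
  induction w using Quotient.ind with | _ b
  exact Quotient.sound ⟨h, he⟩

theorem tilde_mor_ext {f g : (Λ.tilde hΛ).Mor} (h : Λ.projMor hΛ f = Λ.projMor hΛ g)
    (he : excess ((Λ.tilde hΛ).r f) = excess ((Λ.tilde hΛ).r g))
    (hd : (Λ.tilde hΛ).deg f = (Λ.tilde hΛ).deg g) : f = g := by
  induction f using Quotient.ind with | _ a
  induction g using Quotient.ind with | _ b
  exact Quotient.sound ⟨h, he, hd⟩

theorem r_projMor (f : (Λ.tilde hΛ).Mor) :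
    Λ.r (Λ.projMor hΛ f) = Λ.projObj hΛ ((Λ.tilde hΛ).r f) := by
  induction f using Quotient.ind with | _ a
  exact a.r_base

theorem s_projMor (f : (Λ.tilde hΛ).Mor) :
    Λ.s (Λ.projMor hΛ f) = Λ.projObj hΛ ((Λ.tilde hΛ).s f) := by
  induction f using Quotient.ind with | _ a
  exact a.s_base

theorem projMor_composable {f g : (Λ.tilde hΛ).Mor}
    (h : (Λ.tilde hΛ).s f = (Λ.tilde hΛ).r g) :
    Λ.s (Λ.projMor hΛ f) = Λ.r (Λ.projMor hΛ g) := by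
  rw [s_projMor, r_projMor, h]

theorem projMor_comp (f g : (Λ.tilde hΛ).Mor) (h : (Λ.tilde hΛ).s f = (Λ.tilde hΛ).r g) :
    Λ.projMor hΛ ((Λ.tilde hΛ).comp f g h) =
      Λ.comp (Λ.projMor hΛ f) (Λ.projMor hΛ g) (projMor_composable h) := by
  induction f using Quotient.ind with | _ a
  induction g using Quotient.ind with | _ b
  exact (congrArg (Λ.projMor hΛ) (tcomp_mk hΛ a b h)).trans (compRep_base hΛ a b _)

/-- The part of the degree of `f` that its projection does not realise accumulates as excess. -/
theorem excess_s (f : (Λ.tilde hΛ).Mor) : excess ((Λ.tilde hΛ).s f) =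
    excess ((Λ.tilde hΛ).r f) + (Λ.tilde hΛ).deg f - Λ.deg (Λ.projMor hΛ f) := by
  induction f using Quotient.ind with | _ a
  exact a.right_excess

/-- Positive excess means that the underlying path is exhausted in direction `i`. Otherwise the
projection advances at every step until exhaustion, so an initial factor realises as much of its
degree as the whole path allows. -/
theorem deg_projMor_left (f g : (Λ.tilde hΛ).Mor)
    (h : (Λ.tilde hΛ).s f = (Λ.tilde hΛ).r g) (i : Fin k) :
    Λ.deg (Λ.projMor hΛ f) i = if excess ((Λ.tilde hΛ).r f) i = 0 then
      min ((Λ.tilde hΛ).deg f i)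
        (Λ.deg (Λ.projMor hΛ ((Λ.tilde hΛ).comp f g h)) i) else 0 := by
  rw [projMor_comp]
  induction f using Quotient.ind with | _ a
  induction g using Quotient.ind with | _ b
  exact deg_base_left (Quotient.exact h) i

/-- Positive excess puts `x(m ∧ d(x))` at the end of `x` in direction `i`, where the boundary
condition forbids edges. -/
theorem excess_eq_zero_of_receives (v : (Λ.tilde hΛ).Obj) (i : Fin k)
    (h : Λ.Receives (Λ.projObj hΛ v) i) : excess v i = 0 := by
  induction v using Quotient.ind with | _ a
  change a.m i - meet a.m a.x.dg i = 0
  rcases meet_cases a.m a.x.dg i with ⟨_, h2⟩ | ⟨b, h1, h2⟩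
  · omega
  · by_contra hne
    exact a.x.boundary _ (below_meet _ _) i (by rw [h1, h2, min_eq_right (by omega)]) h

/-- A step in direction `i` that projects to nothing starts at or beyond the end of the underlying
boundary path. -/
theorem not_receives_of_deg_projMor_eq_zero (f : (Λ.tilde hΛ).Mor) (i : Fin k)
    (hf : (Λ.tilde hΛ).deg f i ≠ 0) (h : Λ.deg (Λ.projMor hΛ f) i = 0) :
    ¬ Λ.Receives (Λ.projObj hΛ ((Λ.tilde hΛ).r f)) i := by
  induction f using Quotient.ind with | _ a
  have h1 : a.n i - a.m i ≠ 0 := hf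
  have h2 : Λ.deg a.base i = 0 := h
  rw [a.deg_base, Pi.sub_apply] at h2
  refine a.x.boundary _ (below_meet _ _) i ?_
  change (meet a.m a.x.dg i : ℕ∞) = _
  rcases meet_cases a.m a.x.dg i with ⟨h3, h4⟩ | ⟨b, h3, h4⟩
  · rw [meet_top h3, meet_top h3] at h2; omega
  · rw [meet_nat h3, meet_nat h3] at h2
    rw [h3, h4, min_eq_right (by omega)]

/-! ### Correspondence between boundary paths of `Λ̃` and of `Λ` -/

theorem tilde_receives (v : (Λ.tilde hΛ).Obj) (i : Fin k) : (Λ.tilde hΛ).Receives v i := by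
  induction v using Quotient.ind with | _ a
  exact ⟨Quotient.mk (pathSetoid Λ) ⟨a.x, a.m, a.m + Pi.single i 1, le_self_add⟩, rfl,
    add_tsub_cancel_left a.m _⟩

theorem tilde_below (X : BoundaryPath (Λ.tilde hΛ)) (q : Fin k → ℕ) : Below q X.dg :=
  X.below_of_receives tilde_receives q

theorem dg_eq_zero_of_excess {v : (Λ.tilde hΛ).Obj} {y : BoundaryPath Λ}
    (hy : y.range = Λ.projObj hΛ v) {i : Fin k} (h : excess v i ≠ 0) : y.dg i = 0 := by
  by_contra hne
  exact h (excess_eq_zero_of_receives v i (hy ▸ y.receives_of_dg_ne_zero hne))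

theorem meet_excess_add {v : (Λ.tilde hΛ).Obj} {y : BoundaryPath Λ}
    (hy : y.range = Λ.projObj hΛ v) (p : Fin k → ℕ) :
    meet (excess v + p) y.dg = meet p y.dg := by
  funext i
  by_cases h : excess v i = 0
  · rcases meet_cases p y.dg i with ⟨h1, h2⟩ | ⟨b, h1, h2⟩
    · rw [meet_top h1, h2, Pi.add_apply, h, zero_add]
    · rw [meet_nat h1, h2, Pi.add_apply, h, zero_add]
  · have h0 : y.dg i = (0 : ℕ) := dg_eq_zero_of_excess hy h
    rw [meet_nat h0, meet_nat h0, min_eq_right (Nat.zero_le _), min_eq_right (Nat.zero_le _)]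

/-- `X` is the boundary path `(p, q) ↦ [y; (a + p, a + q)]` of `Λ̃`, where `a` is the excess of
its range. -/
structure Lifts (X : BoundaryPath (Λ.tilde hΛ)) (y : BoundaryPath Λ) : Prop where
  proj_map : ∀ p q hpq hq, Λ.projMor hΛ (X.map p q hpq hq) =
    y.map (meet p y.dg) (meet q y.dg) (meet_mono hpq _) (below_meet _ _)
  excess_obj : ∀ p hp, excess (X.obj p hp) = excess X.range + (p - meet p y.dg)

/-- Starting at position `a`, the excess of `v`, instead of 0 gives the range its excess without
moving along `y`, by `meet_excess_add`. -/
theorem exists_lift (v : (Λ.tilde hΛ).Obj) (y : BoundaryPath Λ)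
    (hy : y.range = Λ.projObj hΛ v) : ∃ X, X.range = v ∧ Lifts X y := by
  have hm := meet_excess_add hy
  have hsub : ∀ p, excess v + p - meet (excess v + p) y.dg = excess v + (p - meet p y.dg) := by
    intro p
    rw [hm, add_tsub_assoc_of_le (meet_le _ _)]
  let P : (p q : Fin k → ℕ) → p ≤ q → PrePath Λ := fun p q h =>
    ⟨y, excess v + p, excess v + q, add_le_add_right h _⟩
  let X : BoundaryPath (Λ.tilde hΛ) :=
    { dg := fun _ => ⊤
      obj := fun p _ => Quotient.mk (vertexSetoid Λ) ⟨y, excess v + p⟩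
      map := fun p q h _ => Quotient.mk (pathSetoid Λ) (P p q h)
      r_map := fun _ _ _ _ => rfl
      s_map := fun _ _ _ _ => rfl
      map_id := fun _ _ => rfl
      map_comp := fun p q t hpq hqt _ => by
        refine (tcomp_mk hΛ (P p q hpq) (P q t hqt) rfl).trans (Quotient.sound ⟨?_, ?_, ?_⟩)
        · rw [compRep_base]
          exact y.map_comp _ _ _ _ _ _
        · exact compRep_excess ..
        · rw [compRep_deg]
          funext i
          have h1 : p i ≤ q i := hpq i
          have h2 : q i ≤ t i := hqt i
          simp only [P, Pi.add_apply, Pi.sub_apply]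
          omega
      deg_map := fun p q _ _ => add_tsub_add_eq_tsub_left (excess v) q p
      boundary := fun p _ i h => absurd h (by simp) }
  have hX : X.range = v := by
    refine tilde_obj_ext ?_ ?_
    · exact (y.obj_congr ((hm 0).trans (meet_of_below (below_zero _))) _).trans hy
    · refine (hsub 0).trans ?_
      rw [zero_tsub, add_zero]
  refine ⟨X, hX, ⟨fun p q hpq _ => map_congr y (hm p) (hm q) _ _, fun p _ => ?_⟩⟩
  rw [hX]
  exact hsub p

/-- The projected segments `π(X(0, q))` stop growing where `y` must end. Their degrees `D q` have a
supremum `δ` with `D q = q ∧ δ`, so restricting the projection to positions below `δ` preserves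
degrees and gives `y`. -/
theorem exists_lifts (X : BoundaryPath (Λ.tilde hΛ)) :
    ∃ y : BoundaryPath Λ, y.range = Λ.projObj hΛ X.range ∧ Lifts X y := by
  have hX := tilde_below X
  let M : (p q : Fin k → ℕ) → p ≤ q → Λ.Mor := fun p q h => Λ.projMor hΛ (X.map p q h (hX q))
  let D : (Fin k → ℕ) → Fin k → ℕ := fun q => Λ.deg (M 0 q (fun _ => Nat.zero_le _))
  have hr : ∀ p q h, Λ.r (M p q h) = Λ.projObj hΛ (X.obj p (hX p)) := fun p q h => by
    rw [r_projMor, X.r_map]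
  have hs : ∀ p q h, Λ.s (M p q h) = Λ.projObj hΛ (X.obj q (hX q)) := fun p q h => by
    rw [s_projMor, X.s_map]
  have hM : ∀ p q t hpq hqt, Λ.comp (M p q hpq) (M q t hqt)
      ((hs _ _ _).trans (hr _ _ _).symm) = M p t (hpq.trans hqt) := fun p q t hpq hqt => by
    rw [← projMor_comp _ _ ((X.s_map _ _ _ _).trans (X.r_map _ _ _ _).symm), X.map_comp]
  have hD : ∀ p q h, D q = D p + Λ.deg (M p q h) := fun p q h => by
    simp only [D]
    rw [← Λ.deg_comp _ _ ((hs _ _ _).trans (hr _ _ _).symm), hM]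
  have hmin : ∀ p q, p ≤ q → ∀ i, D p i = min (p i) (D q i) := by
    have h1 : ∀ p q, p ≤ q → ∀ i, D p i = if excess X.range i = 0 then
        min (p i) (D q i) else 0 := fun p q h i => by
      have h2 := deg_projMor_left (X.map 0 p (fun _ => Nat.zero_le _) (hX p))
        (X.map p q h (hX q)) ((X.s_map _ _ _ _).trans (X.r_map _ _ _ _).symm) i
      rw [X.map_comp, X.r_map, X.deg_map, tsub_zero] at h2
      exact h2
    intro p q h i
    have h2 := h1 p q h i
    have h3 := h1 q q le_rfl i
    split_ifs at h2 h3 <;> omega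
  let δ : Fin k → ℕ∞ := fun i => ⨆ q, (D q i : ℕ∞)
  have hle : ∀ q i, (D q i : ℕ∞) ≤ δ i := fun q i => le_iSup (fun q => (D q i : ℕ∞)) q
  have hδ : ∀ q, D q = meet q δ := by
    -- For the lower bound, some `q'` realises at least `(q ∧ δ) i`; comparing `q` and `q'` with `q
    -- ⊔ q'` transfers this to `D q`.
    intro q
    funext i
    have h1 : (meet q δ i : ℕ∞) ≤ δ i := below_meet q δ i
    obtain ⟨q', hq'⟩ := exists_le_of_le_iSup h1
    have h2 := hmin q (q ⊔ q') le_sup_left i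
    have h3 := hmin q' (q ⊔ q') le_sup_right i
    have h4 : meet q δ i ≤ q i := meet_le q δ i
    rcases meet_cases q δ i with ⟨h5, h6⟩ | ⟨b, h5, h6⟩
    · omega
    · have h7 := hle q i
      rw [h5] at h7
      have h8 : D q i ≤ b := by exact_mod_cast h7
      omega
  have hδ' : ∀ q, Below q δ → D q = q := fun q hq => (hδ q).trans (meet_of_below hq)
  let y : BoundaryPath Λ :=
    { dg := δ
      obj := fun p _ => Λ.projObj hΛ (X.obj p (hX p))
      map := fun p q h _ => M p q h
      r_map := fun p q h _ => hr p q h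
      s_map := fun p q h _ => hs p q h
      map_id := fun p _ => by
        rw [← projMor_id, ← X.map_id]
      map_comp := fun p q t hpq hqt _ => hM p q t hpq hqt
      deg_map := fun p q hpq hq => by
        have h1 := hD p q hpq
        rw [hδ' q hq, hδ' p (Below.mono hpq hq)] at h1
        exact (tsub_eq_of_eq_add_rev h1).symm
      boundary := fun p hp i hi => by
        -- At `p i = δ i` a further step `e_i` in `X` cannot increase `D`, so it projects to degree
        -- zero in direction `i`.
        have h1 := hD p (p + Pi.single i 1) le_self_add
        have h2 := hle (p + Pi.single i 1) i
        rw [← hi] at h2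
        have h3 : D (p + Pi.single i 1) i ≤ p i := by exact_mod_cast h2
        have h4 := congrFun h1 i
        rw [hδ' p hp, Pi.add_apply] at h4
        have h5 := not_receives_of_deg_projMor_eq_zero
          (X.map p (p + Pi.single i 1) le_self_add (hX _)) i
          (by rw [X.deg_map, add_tsub_cancel_left, Pi.single_eq_same]; exact one_ne_zero)
          (by change Λ.deg (M p _ le_self_add) i = 0; omega)
        rwa [X.r_map] at h5 }
  -- Beyond `q ∧ δ` the projection has degree zero, so it adds nothing.
  have hinit : ∀ q, M 0 q (fun _ => Nat.zero_le _) =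
      M 0 (meet q δ) (fun _ => Nat.zero_le _) := fun q => by
    rw [← hM 0 (meet q δ) q (fun _ => Nat.zero_le _) (meet_le _ _)]
    refine comp_of_deg_eq_zero _ _ _ ?_
    have h1 := hD (meet q δ) q (meet_le _ _)
    rw [hδ' _ (below_meet _ _), hδ q] at h1
    exact add_eq_left.mp h1.symm
  refine ⟨y, rfl, ⟨fun p q hpq hq => ?_, fun p hp => ?_⟩⟩
  · refine (comp_cancel (f := M 0 p (fun _ => Nat.zero_le _))
      (f' := M 0 (meet p δ) (fun _ => Nat.zero_le _)) ((hM 0 p q _ hpq).trans ((hinit q).trans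
      (hM 0 (meet p δ) (meet q δ) _ (meet_mono hpq _)).symm)) (congrArg Λ.deg (hinit p))).2
  · have h1 := excess_s (X.map 0 p (fun _ => Nat.zero_le _) hp)
    rw [X.s_map, X.r_map, X.deg_map, tsub_zero] at h1
    refine h1.trans ?_
    change _ - D p = _
    rw [hδ p, add_tsub_assoc_of_le (meet_le _ _)]
    rfl

/-! ### Transfer of periodicity -/

/-- The periodicity conditions agree for a boundary path and its lift. -/
theorem Lifts.periodic_iff {X : BoundaryPath (Λ.tilde hΛ)} {y : BoundaryPath Λ} (h : Lifts X y)
    (m n : Fin k → ℕ) :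
    (m - meet m X.dg = n - meet n X.dg ∧
      X.shift (meet m X.dg) (below_meet m X.dg) = X.shift (meet n X.dg) (below_meet n X.dg)) ↔
    (m - meet m y.dg = n - meet n y.dg ∧
      y.shift (meet m y.dg) (below_meet m y.dg) = y.shift (meet n y.dg) (below_meet n y.dg)) := by
  have hX := tilde_below X
  have hXm : ∀ m, meet m X.dg = m := fun m => meet_of_below (hX m)
  have hXd : ∀ i, X.dg i = ⊤ := fun i => by
    refine ENat.eq_top_iff_forall_ge.mpr fun a => ?_
    exact hX (fun _ => a) i
  rw [X.shift_congr (hXm m) _ (hX m), X.shift_congr (hXm n) _ (hX n), hXm, hXm]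
  constructor
  · rintro ⟨-, h1⟩
    have h2 : ∀ p q hpq, X.map (p + m) (q + m) (add_le_add_left hpq m) (hX _) =
        X.map (p + n) (q + n) (add_le_add_left hpq n) (hX _) := fun p q hpq =>
      BoundaryPath.map_eq_of_shift_eq h1 p q hpq _ _ fun i => by
        change _ ≤ X.dg i - _
        rw [hXd, ENat.top_sub_natCast]; exact le_top
    have h3 : ∀ p, (p + m) - meet (p + m) y.dg = (p + n) - meet (p + n) y.dg := fun p => by
      have h4 := congrArg (fun f => excess ((Λ.tilde hΛ).r f)) (h2 p p le_rfl)
      simp only [X.r_map, h.excess_obj] at h4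
      exact add_left_cancel h4
    -- At the position with all entries `a = d(y) i`, both truncations equal `a` in direction `i`,
    -- so the excesses there are `m i` and `n i`.
    have h4 : ∀ i a, y.dg i = (a : ℕ) → m i = n i := fun i a hi => by
      have h5 := congrFun (h3 fun _ => a) i
      simp only [Pi.sub_apply, Pi.add_apply, meet_nat hi] at h5
      omega
    have hd : ∀ i, y.dg i - meet m y.dg i = y.dg i - meet n y.dg i := fun i => by
      rcases meet_cases m y.dg i with ⟨h5, h6⟩ | ⟨a, h5, h6⟩
      · rw [h5, ENat.top_sub_natCast, ENat.top_sub_natCast]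
      · rw [meet_nat h5, meet_nat h5, h4 i a h5]
    refine ⟨by simpa using h3 0, BoundaryPath.map_ext (funext hd) fun p q hpq hq hq' => ?_⟩
    have h5 := congrArg (Λ.projMor hΛ) (h2 p q hpq)
    rw [h.proj_map, h.proj_map] at h5
    have h6 : ∀ p, Below p (fun i => y.dg i - meet m y.dg i) →
        meet (p + m) y.dg = p + meet m y.dg := fun p hp => by
      rw [meet_add_right, meet_of_below hp]
    have h7 : ∀ p, Below p (fun i => y.dg i - meet n y.dg i) →
        meet (p + n) y.dg = p + meet n y.dg := fun p hp => by
      rw [meet_add_right, meet_of_below hp]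
    exact ((map_congr y (h6 p (Below.mono hpq hq)) (h6 q hq) _ _).symm.trans h5).trans
      (map_congr y (h7 p (Below.mono hpq hq')) (h7 q hq') _ _)
  · rintro ⟨h1, h2⟩
    have hd : (fun i => y.dg i - (meet m y.dg i : ℕ∞)) = fun i => y.dg i - (meet n y.dg i : ℕ∞) :=
      congrArg BoundaryPath.dg h2
    have h3 : ∀ p, meet (p + m) y.dg = meet p (fun i => y.dg i - meet m y.dg i) + meet m y.dg :=
      fun p => meet_add_right _ _ _
    -- Equal shifts have equal degrees, so `p` is truncated to the same offset after `m` as after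
    -- `n`.
    have h4 : ∀ p, meet (p + n) y.dg = meet p (fun i => y.dg i - meet m y.dg i) + meet n y.dg :=
      fun p => by rw [meet_add_right, hd]
    refine ⟨by rw [tsub_self, tsub_self], BoundaryPath.map_ext ?_ fun p q hpq hq hq' => ?_⟩
    · funext i
      change X.dg i - _ = X.dg i - _
      rw [hXd, ENat.top_sub_natCast, ENat.top_sub_natCast]
    · change X.map (p + m) (q + m) _ _ = X.map (p + n) (q + n) _ _
      refine tilde_mor_ext ?_ ?_ ?_
      · rw [h.proj_map, h.proj_map, map_congr y (h3 p) (h3 q), map_congr y (h4 p) (h4 q)]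
        exact BoundaryPath.map_eq_of_shift_eq h2 _ _ (meet_mono hpq _) _ _ (below_meet _ _)
      · rw [X.r_map, X.r_map, h.excess_obj, h.excess_obj, h3, h4]
        congr 1
        funext i
        have h5 := congrFun h1 i
        have h6 : meet m y.dg i ≤ m i := meet_le m y.dg i
        have h7 : meet n y.dg i ≤ n i := meet_le n y.dg i
        have h8 := meet_le p (fun i => y.dg i - meet m y.dg i) i
        simp only [Pi.sub_apply, Pi.add_apply] at h5 ⊢
        omega
      · rw [X.deg_map, X.deg_map]
        funext i
        simp only [Pi.sub_apply, Pi.add_apply]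
        omega

theorem tilde_localPeriodicity_iff (v : (Λ.tilde hΛ).Obj) (m n : Fin k → ℕ) :
    (Λ.tilde hΛ).LocalPeriodicity m n v ↔ Λ.LocalPeriodicity m n (Λ.projObj hΛ v) := by
  constructor
  · intro h y hy
    obtain ⟨X, hX, hXy⟩ := exists_lift v y hy
    exact (hXy.periodic_iff m n).mp (h X hX)
  · intro h X hX
    obtain ⟨y, hy, hXy⟩ := exists_lifts X
    exact (hXy.periodic_iff m n).mpr (h y (hy.trans (congrArg _ hX)))

/-- Needed to pull a periodic vertex of `Λ` back to `Λ̃`; a boundary path `x` from `v` gives the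
preimage `[x; 0]`. -/
theorem projObj_surjective : Function.Surjective (Λ.projObj hΛ) := by
  intro v
  obtain ⟨x, hx⟩ := hΛ.exists_boundaryPath v
  exact ⟨Quotient.mk (vertexSetoid Λ) ⟨x, 0⟩,
    (x.obj_congr (meet_of_below (below_zero _)) _).trans hx⟩

end Tilde

end KGraph

theorem mainTheorem6 {k : ℕ} (hk : 0 < k) (Λ : KGraph.{u} k) (hrow : Λ.RowFinite)
    (hconv : Λ.LocallyConvex) :
    (∀ (v : (Λ.tilde hconv).Obj) (m n : Fin k → ℕ), m ≠ n →
      ((Λ.tilde hconv).LocalPeriodicity m n v ↔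
        Λ.LocalPeriodicity m n (Λ.projObj hconv v))) ∧
    ((Λ.tilde hconv).NoLocalPeriodicity ↔ Λ.NoLocalPeriodicity) := by
  refine ⟨fun v m n _ => KGraph.tilde_localPeriodicity_iff v m n, fun h m n hmn w hw => ?_,
    fun h m n hmn v hv => h m n hmn _ ((KGraph.tilde_localPeriodicity_iff v m n).mp hv)⟩
  obtain ⟨v, rfl⟩ := KGraph.projObj_surjective (hΛ := hconv) w
  exact h m n hmn v ((KGraph.tilde_localPeriodicity_iff v m n).mpr hw)
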